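/- Let $\lambda=(\lambda_1\ge\lambda_2\ge\dots\ge\lambda_m\ge 1)$ be a partition of $N=\lambda_1+\dots+\lambda_m$, viewed as a Young diagram with $\lambda_i$ boxes in the $i$-th row (left-justified, first row on top). A row-standard filling of $\lambda$ puts positive integers in the boxes so that no integer is skipped (if $v$ occurs, so do $1,\dots,v-1$) and the entries strictly increase from left to right in every row. Two entries $i,j$ in the same column form an inversion pair $(i,j)$ if $i<j$ and, for some $n\ge 0$, the entries $i_k$ and $j_k$ that lie $k$ boxes to the right of $i$ and of $j$ exist and satisfy $i_k=j_k$ for all $1\le k\le n$, and moreover either (a) $i_{n+1}$ or $j_{n+1}$ does not exist and $i$ lies below $j$, or (b) both exist and $i_{n+1}>j_{n+1}$. Let $S_k(\lambda)$ be the set of row-standard fillings of $\lambda$ without repeated entries that have exactly $k$ inversion pairs. An $m$-dimensional Dyck path of shape $\lambda$ is a sequence $v_0,\dots,v_N\in\mathbb Z^m$ with $v_0=0$ and $v_N=(\lambda_1,\dots,\lambda_m)$, such that each $v_i-v_{i-1}$ is a standard unit vector and each $v_i=(x_1,\dots,x_m)$ satisfies $x_1\ge x_2\ge\dots\ge x_m$.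 If $v_i-v_{i-1}=\hat e_\gamma$ and $v_i=(x_1',\dots,x_m')$, the path has a return to ground of degree $d$ at $v_i$ if $d<\gamma$, $x'_{\gamma-d}=x'_{\gamma-d+1}=\dots=x'_\gamma$, and either $\gamma-d=1$ or $x'_{\gamma-d-1}\ne x'_\gamma$. Let $\mathcal D_\lambda(i_1,\dots,i_{m-1})$ be the set of $m$-dimensional Dyck paths of shape $\lambda$ that have exactly $i_j$ returns to ground of degree $j$ for every $1\le j\le m-1$. Write $[p]_q=1+q+\dots+q^{p-1}$. Theorem. As polynomials in $q$, $$\sum_{k\ge 0}|S_k(\lambda)|\,q^k=\sum_{(i_1,\dots,i_{m-1})\in\mathbb Z_{\ge 0}^{m-1}}|\mathcal D_\lambda(i_1,\dots,i_{m-1})|\prod_{j=1}^{m-1}[j+1]_q^{\,i_j}.$$ -/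

import Mathlib

open scoped Polynomial

/-- A row-standard filling of the Young diagram `Y` (English notation, cell `(r, c)` is in row `r`
and column `c`, both counted from `0`, row `0` on top): positive integers are put in the cells,
no integer is skipped, and the entries strictly increase from left to right in every row.
As for Mathlib's `SemistandardYoungTableau`, the entry outside the diagram is `0`, so that
equality of fillings is equality on the cells. -/
@[ext]
structure RowStandardFilling (Y : YoungDiagram) where
  entry : ℕ → ℕ → ℕ
  zeros : ∀ r c, (r, c) ∉ Y → entry r c = 0
  pos : ∀ r c, (r, c) ∈ Y → 0 < entry r c
  no_skip : ∀ r c, (r, c) ∈ Y → ∀ v, 0 < v → v ≤ entry r c →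
    ∃ r' c', (r', c') ∈ Y ∧ entry r' c' = v
  row_strict : ∀ r c₁ c₂, c₁ < c₂ → (r, c₂) ∈ Y → entry r c₁ < entry r c₂

namespace RowStandardFilling

variable {Y : YoungDiagram}

/-- The entries `i` in cell `(r, c)` and `j` in cell `(s, c)` of the same column `c` form an
inversion pair `(i, j)`: `i < j` and, for some `n ≥ 0`, the entries `k` boxes to the right of `i`
and of `j` exist and agree for `1 ≤ k ≤ n`, and either one of the two entries `n + 1` boxes to
the right does not exist and `i` appears below `j`, or both exist and the one to the right of `i`
is the larger. (`n = 0` means that the entries directly to the right already decide.) -/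
def IsInversion (τ : RowStandardFilling Y) (c r s : ℕ) : Prop :=
  (r, c) ∈ Y ∧ (s, c) ∈ Y ∧ τ.entry r c < τ.entry s c ∧
    ∃ n : ℕ,
      (∀ k, 1 ≤ k → k ≤ n →
        (r, c + k) ∈ Y ∧ (s, c + k) ∈ Y ∧ τ.entry r (c + k) = τ.entry s (c + k)) ∧
      ((((r, c + (n + 1)) ∉ Y ∨ (s, c + (n + 1)) ∉ Y) ∧ s < r) ∨
        ((r, c + (n + 1)) ∈ Y ∧ (s, c + (n + 1)) ∈ Y ∧
          τ.entry s (c + (n + 1)) < τ.entry r (c + (n + 1))))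

open Classical in
/-- The number of inversion pairs: pairs of cells `((r, c), (s, c))` whose entries form
an inversion pair. -/
noncomputable def inv (τ : RowStandardFilling Y) : ℕ :=
  ((Y.cells ×ˢ Y.cells).filter
    (fun p => p.1.2 = p.2.2 ∧ τ.IsInversion p.1.2 p.1.1 p.2.1)).card

/-- The filling has no repeated entries. -/
def NoRepeats (τ : RowStandardFilling Y) : Prop :=
  ∀ r c r' c', (r, c) ∈ Y → (r', c') ∈ Y → τ.entry r c = τ.entry r' c' → r = r' ∧ c = c'

theorem entry_le_card (τ : RowStandardFilling Y) (r c : ℕ) : τ.entry r c ≤ Y.cells.card := by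
  by_cases h : (r, c) ∈ Y
  · have hsub : Finset.Icc 1 (τ.entry r c) ⊆ Y.cells.image (fun p => τ.entry p.1 p.2) := by
      intro v hv
      rw [Finset.mem_Icc] at hv
      obtain ⟨r', c', hm, he⟩ := τ.no_skip r c h v hv.1 hv.2
      exact Finset.mem_image.2 ⟨(r', c'), hm, he⟩
    have h1 := (Finset.card_le_card hsub).trans Finset.card_image_le
    simpa using h1
  · simp [τ.zeros r c h]

/-- A diagram has only finitely many row-standard fillings. -/
instance : Finite (RowStandardFilling Y) := by
  refine Finite.of_injective
    (fun (τ : RowStandardFilling Y) (p : Y.cells) =>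
      (⟨τ.entry p.1.1 p.1.2, Nat.lt_succ_of_le (τ.entry_le_card _ _)⟩ :
        Fin (Y.cells.card + 1))) ?_
  intro τ σ h
  ext r c
  by_cases hm : (r, c) ∈ Y
  · have := congrFun h ⟨(r, c), hm⟩
    simpa using this
  · rw [τ.zeros r c hm, σ.zeros r c hm]

end RowStandardFilling

/-- The set `S_k(Y)` of `k`-inverted standard Young tableaux of shape `Y`. -/
def invertedSYT (Y : YoungDiagram) (k : ℕ) : Set (RowStandardFilling Y) :=
  {τ | τ.NoRepeats ∧ τ.inv = k}

/-- An `m`-dimensional Dyck path of shape `lam = (lam 0, …, lam (m - 1))`: a lattice path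
`v_0, …, v_N` in `ℤ^m`, with `N = ∑ i, lam i`, from `0` to `lam`, all of whose steps are unit
coordinate vectors and all of whose points have weakly decreasing coordinates. -/
@[ext]
structure MultiDyckPath {m : ℕ} (lam : Fin m → ℕ) where
  vertex : Fin ((∑ i, lam i) + 1) → Fin m → ℤ
  vertex_zero : vertex 0 = 0
  vertex_last : vertex (Fin.last _) = fun i => (lam i : ℤ)
  step : ∀ t : Fin (∑ i, lam i), ∃ j : Fin m,
    vertex t.succ = vertex t.castSucc + Pi.single j 1
  antitone : ∀ t, Antitone (vertex t)

namespace MultiDyckPath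

variable {m : ℕ} {lam : Fin m → ℕ}

/-- A shape has only finitely many Dyck paths, since a path is determined by its steps. -/
instance : Finite (MultiDyckPath lam) := by
  classical
  refine Finite.of_injective
    (fun (P : MultiDyckPath lam) (t : Fin (∑ i, lam i)) => (P.step t).choose) ?_
  intro P Q h
  apply MultiDyckPath.ext
  funext t
  induction t using Fin.induction with
  | zero => rw [P.vertex_zero, Q.vertex_zero]
  | succ t ih =>
    have hc : (P.step t).choose = (Q.step t).choose := congrFun h t
    exact (P.step t).choose_spec.trans
      ((congrArg₂ (fun v j => v + Pi.single j (1 : ℤ)) ih hc).trans (Q.step t).choose_spec.symm)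

/-- `P` has a `d`-degree return to ground at the end of its step `t`, that is at the point
`v_{t+1}` (`t` counted from `0`): the step is in some coordinate `g`; in `v_{t+1}` the coordinates
`g - d, …, g` exist and are all equal, and the coordinate `g - d - 1`, if it exists, is
different from them. -/
def IsReturn (P : MultiDyckPath lam) (d : ℕ) (t : Fin (∑ i, lam i)) : Prop :=
  ∃ g : Fin m, P.vertex t.succ = P.vertex t.castSucc + Pi.single g 1 ∧
    d ≤ (g : ℕ) ∧
    (∀ l : Fin m, (g : ℕ) ≤ l + d → l ≤ g → P.vertex t.succ l = P.vertex t.succ g) ∧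
    (∀ l : Fin m, (l : ℕ) + d + 1 = g → P.vertex t.succ l ≠ P.vertex t.succ g)

open Classical in
/-- The number of `d`-degree returns to ground of `P`. -/
noncomputable def returnCount (P : MultiDyckPath lam) (d : ℕ) : ℕ :=
  (Finset.univ.filter (fun t => P.IsReturn d t)).card

end MultiDyckPath

/-- The set `D_lam(i_1, …, i_{m-1})` of Dyck paths of shape `lam` with exactly `i_j` returns to
ground of degree `j` for `1 ≤ j ≤ m - 1`; the number `i_{j+1}` is `e j`, `j = 0, …, m - 2`. -/
def dyckPathsWithReturns {m : ℕ} (lam : Fin m → ℕ) (e : Fin (m - 1) → ℕ) :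
    Set (MultiDyckPath lam) :=
  {P | ∀ j : Fin (m - 1), P.returnCount ((j : ℕ) + 1) = e j}

/-- The `q`-number `[p]_q = 1 + q + ⋯ + q^{p-1}` as a polynomial in `q`. -/
noncomputable def qNumber (p : ℕ) : ℤ[X] := ∑ i ∈ Finset.range p, Polynomial.X ^ i

/-- The tuple of the lengths of the (nonempty) rows of a Young diagram, from top to bottom. -/
def shapeTuple (Y : YoungDiagram) : Fin (Y.colLen 0) → ℕ := fun i => Y.rowLen i

/-! Both sides satisfy the same recursion on partitions, recorded by `weightedChains`: remove a box
from a row `b` that is the last of its length, with weight `[p]_q`, where `p` is the number of rows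
as long as `b` before the removal.

For Dyck paths, delete the last step. It must be in such a coordinate `b`, and the coordinates equal
to the `b`-th at the endpoint form a block of size `p` ending at `b`. The step is therefore a return
of degree `p - 1`, contributing `[p]_q` (`stepWeight_removeBox`); degree `0` contributes `[1]_q =
1`.

For fillings without repeated entries, delete the largest entry, at the end of some row `r₀`. The
other rows keep their entries, so the result need not have partition shape. The induction therefore
runs over compositions `lam ∘ π`, with row `r` at height `π r` when inversions are counted. The
shortened row is moved to the bottom of the block of rows that had its length, which restores
decreasing lengths. Every inversion not involving the deleted entry survives this move, and that
entry is in exactly one inversion for each row of its length below it (`inversionSet_setEntry_max`).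
As `r₀` runs over a block of `p` rows, the numbers lost are `0, …, p - 1`, with the same remaining
partition, which gives the factor `[p]_q`. -/

/-! ### Standard fillings of compositions -/

/-- The composition `α` with one box removed from row `r`. -/
def removeBox {m : ℕ} (α : Fin m → ℕ) (r : Fin m) : Fin m → ℕ :=
  Function.update α r (α r - 1)

/-- The filling `f` with the entry in cell `(r, c)` replaced by `n`. -/
def setEntry {m : ℕ} (f : Fin m → ℕ → ℕ) (r : Fin m) (c n : ℕ) : Fin m → ℕ → ℕ :=
  fun s d => if s = r ∧ d = c then n else f s d

/-- `e` is a filling with the entries `1, …, N`, each used once, of a diagram with row lengths `α`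
whose rows are increasing; the entries outside the diagram are `0`. -/
structure IsStandardFilling {m : ℕ} (N : ℕ) (α : Fin m → ℕ) (e : Fin m → ℕ → ℕ) : Prop where
  zeros : ∀ r c, α r ≤ c → e r c = 0
  pos : ∀ r c, c < α r → 0 < e r c
  le : ∀ r c, e r c ≤ N
  strict : ∀ r c d, c < d → d < α r → e r c < e r d
  inj : ∀ r c s d, c < α r → d < α s → e r c = e s d → r = s ∧ c = d
  surj : ∀ v, 0 < v → v ≤ N → ∃ r c, c < α r ∧ e r c = v

theorem removeBox_self {m : ℕ} (α : Fin m → ℕ) (r : Fin m) : removeBox α r r = α r - 1 := by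
  simp [removeBox]

theorem removeBox_of_ne {m : ℕ} (α : Fin m → ℕ) {r s : Fin m} (h : s ≠ r) :
    removeBox α r s = α s := by
  simp [removeBox, h]

theorem setEntry_self {m : ℕ} (f : Fin m → ℕ → ℕ) (r : Fin m) (c n : ℕ) :
    setEntry f r c n r c = n := by
  simp [setEntry]

theorem setEntry_of_row_ne {m : ℕ} (f : Fin m → ℕ → ℕ) {r s : Fin m} (h : s ≠ r) (c n d : ℕ) :
    setEntry f r c n s d = f s d := by
  simp [setEntry, h]

theorem setEntry_of_col_ne {m : ℕ} (f : Fin m → ℕ → ℕ) {c d : ℕ} (h : d ≠ c) (r s : Fin m)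
    (n : ℕ) : setEntry f r c n s d = f s d := by
  simp [setEntry, h]

namespace IsStandardFilling

variable {m N : ℕ} {α : Fin m → ℕ}

theorem setEntry_max {f : Fin m → ℕ → ℕ} {r : Fin m} (hr : 0 < α r)
    (hf : IsStandardFilling N (removeBox α r) f) :
    IsStandardFilling (N + 1) α (setEntry f r (α r - 1) (N + 1)) := by
  have key : ∀ s d, d < α s → (s = r ∧ d = α r - 1) ∨
      (¬ (s = r ∧ d = α r - 1) ∧ d < removeBox α r s) := by
    intro s d hd
    by_cases hs : s = r
    · subst hs; rw [removeBox_self]; omega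
    · rw [removeBox_of_ne _ hs]; simp [hs, hd]
  have key2 : ∀ s d, d < removeBox α r s → d < α s ∧ ¬ (s = r ∧ d = α r - 1) := by
    intro s d hd
    by_cases hs : s = r
    · subst hs; rw [removeBox_self] at hd; omega
    · rw [removeBox_of_ne _ hs] at hd; simp [hs, hd]
  have hle := hf.le
  constructor
  · intro s d hd
    have h1 : ¬ (s = r ∧ d = α r - 1) := by rintro ⟨rfl, rfl⟩; omega
    simp only [setEntry, h1, if_false]
    apply hf.zeros
    by_contra h
    have := key2 s d (by omega)
    omega
  · intro s d hd
    unfold setEntry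
    rcases key s d hd with h | ⟨h, h'⟩
    · simp [h]
    · simpa [h] using hf.pos s d h'
  · intro s d
    unfold setEntry
    have := hle s d
    split_ifs <;> omega
  · intro s c d hcd hd
    unfold setEntry
    have h1 : ¬ (s = r ∧ c = α r - 1) := by rintro ⟨rfl, rfl⟩; omega
    rw [if_neg h1]
    rcases key s d hd with h | ⟨h, h'⟩
    · rw [if_pos h]; have := hle s c; omega
    · rw [if_neg h]; exact hf.strict s c d hcd h'
  · intro s c t d hc hd
    unfold setEntry
    have h1 := hle s c
    have h2 := hle t d
    rcases key s c hc with h | ⟨h, h'⟩ <;> rcases key t d hd with k | ⟨k, k'⟩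
    · intro _; exact ⟨h.1.trans k.1.symm, h.2.trans k.2.symm⟩
    · rw [if_pos h, if_neg k]; intro; omega
    · rw [if_neg h, if_pos k]; intro; omega
    · rw [if_neg h, if_neg k]; exact hf.inj s c t d h' k'
  · intro v hv hvN
    by_cases h : v = N + 1
    · exact ⟨r, α r - 1, by omega, by simp [setEntry, h]⟩
    · obtain ⟨s, d, hd, he⟩ := hf.surj v hv (by omega)
      obtain ⟨h1, h2⟩ := key2 s d hd
      exact ⟨s, d, h1, by simp [setEntry, h2, he]⟩

theorem exists_max {e : Fin m → ℕ → ℕ} (he : IsStandardFilling (N + 1) α e) :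
    ∃ r, 0 < α r ∧ ∃ f, IsStandardFilling N (removeBox α r) f ∧
      setEntry f r (α r - 1) (N + 1) = e := by
  obtain ⟨r, c, hc, hm⟩ := he.surj (N + 1) (by omega) le_rfl
  have hc' : c = α r - 1 := by
    by_contra h
    have h1 := he.strict r c (c + 1) (by omega) (by omega)
    have h2 := he.le r (c + 1)
    omega
  subst hc'
  have key : ∀ s d, d < α s → ¬ (s = r ∧ d = α r - 1) → d < removeBox α r s := by
    intro s d hd h
    by_cases hs : s = r
    · subst hs; rw [removeBox_self]; omega
    · rwa [removeBox_of_ne _ hs]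
  have key2 : ∀ s d, d < removeBox α r s → d < α s ∧ ¬ (s = r ∧ d = α r - 1) := by
    intro s d hd
    by_cases hs : s = r
    · subst hs; rw [removeBox_self] at hd; omega
    · rw [removeBox_of_ne _ hs] at hd; simp [hs, hd]
  refine ⟨r, by omega, setEntry e r (α r - 1) 0, ⟨?_, ?_, ?_, ?_, ?_, ?_⟩, ?_⟩
  · intro s d hd
    unfold setEntry
    split_ifs with h
    · rfl
    · apply he.zeros
      by_contra h'
      have := key s d (by omega) h
      omega
  · intro s d hd
    obtain ⟨h1, h2⟩ := key2 s d hd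
    simpa [setEntry, h2] using he.pos s d h1
  · intro s d
    unfold setEntry
    split_ifs with h
    · omega
    · by_contra h'
      have h1 : e s d = N + 1 := by have := he.le s d; omega
      have h2 : d < α s := by
        by_contra h3
        have := he.zeros s d (by omega)
        omega
      exact h (he.inj s d r _ h2 hc (h1.trans hm.symm))
  · intro s c d hcd hd
    obtain ⟨h1, h2⟩ := key2 s d hd
    have h3 := (key2 s c (by omega)).2
    simpa [setEntry, h2, h3] using he.strict s c d hcd h1
  · intro s c t d hc' hd
    obtain ⟨h1, h2⟩ := key2 s c hc'
    obtain ⟨h3, h4⟩ := key2 t d hd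
    simpa [setEntry, h2, h4] using he.inj s c t d h1 h3
  · intro v hv hvN
    obtain ⟨s, d, hd, hs⟩ := he.surj v hv (by omega)
    have h : ¬ (s = r ∧ d = α r - 1) := by rintro ⟨rfl, rfl⟩; omega
    exact ⟨s, d, key s d hd h, by simp [setEntry, h, hs]⟩
  · funext s d
    unfold setEntry
    split_ifs with h
    · rw [h.1, h.2, hm]
    · rfl

end IsStandardFilling

open Classical in
/-- The standard fillings of the composition `α` of `N`, built by adding the largest entry at
the end of a row. -/
noncomputable def standardFillings {m : ℕ} : ℕ → (Fin m → ℕ) → Finset (Fin m → ℕ → ℕ)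
  | 0, α => if α = 0 then {0} else ∅
  | N + 1, α => (Finset.univ.filter fun r => 0 < α r).biUnion fun r =>
      (standardFillings N (removeBox α r)).image fun f => setEntry f r (α r - 1) (N + 1)

theorem mem_standardFillings {m : ℕ} (N : ℕ) (α : Fin m → ℕ) (e : Fin m → ℕ → ℕ) :
    e ∈ standardFillings N α ↔ IsStandardFilling N α e := by
  induction N generalizing α e with
  | zero =>
    rw [standardFillings]
    constructor
    · intro h
      split_ifs at h with h0
      · subst h0
        rw [Finset.mem_singleton] at h
        subst h
        constructor <;> simp
        omega
      · simp at h
    · intro h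
      have h0 : α = 0 := by
        funext r
        by_contra hr
        have h1 := h.pos r 0 (Nat.pos_of_ne_zero hr)
        have h2 := h.le r 0
        omega
      rw [if_pos h0, Finset.mem_singleton]
      funext r c
      simpa using h.le r c
  | succ N ih =>
    simp only [standardFillings, Finset.mem_biUnion, Finset.mem_filter, Finset.mem_univ, true_and,
      Finset.mem_image, ih]
    constructor
    · rintro ⟨r, hr, f, hf, rfl⟩
      exact hf.setEntry_max hr
    · intro h
      exact h.exists_max

theorem sum_standardFillings_succ {m N : ℕ} {M : Type*} [AddCommMonoid M] (α : Fin m → ℕ)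
    (F : (Fin m → ℕ → ℕ) → M) :
    ∑ e ∈ standardFillings (N + 1) α, F e =
      ∑ r with 0 < α r, ∑ f ∈ standardFillings N (removeBox α r),
        F (setEntry f r (α r - 1) (N + 1)) := by
  classical
  rw [standardFillings, Finset.sum_biUnion]
  · refine Finset.sum_congr rfl fun r hr => ?_
    rw [Finset.sum_image]
    · intro f hf g hg h
      have hf' := (mem_standardFillings _ _ _).1 hf
      have hg' := (mem_standardFillings _ _ _).1 hg
      funext s d
      by_cases hs : s = r ∧ d = α r - 1
      -- The overwritten cell lies outside the smaller diagram, so no information was lost there.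
      · rw [hf'.zeros s d, hg'.zeros s d] <;> rw [hs.1, hs.2, removeBox_self]
      · simpa [setEntry, hs] using congrFun (congrFun h s) d
  · intro r hr s hs hrs
    rw [Function.onFun, Finset.disjoint_left]
    simp only [Finset.mem_image, mem_standardFillings]
    rintro _ ⟨f, hf, rfl⟩ ⟨g, hg, h⟩
    -- The families for different rows are disjoint: at the end of row `r` one filling has `N + 1`,
    -- the other an entry at most `N`.
    have h1 := congrFun (congrFun h r) (α r - 1)
    rw [setEntry_self, setEntry_of_row_ne _ hrs] at h1
    have := hg.le r (α r - 1)
    omega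

/-! ### Inversions with respect to a vertical order of the rows -/

/-- The inversion pairs, as triples of a column and the rows of the smaller and larger entry, of a
filling `e` with row lengths `α`, where `p r` is the vertical position of row `r`. -/
def inversionSet {m : ℕ} (α : Fin m → ℕ) (p : Fin m → Fin m) (e : Fin m → ℕ → ℕ) :
    Set (ℕ × Fin m × Fin m) :=
  {x | x.1 < α x.2.1 ∧ x.1 < α x.2.2 ∧ e x.2.1 x.1 < e x.2.2 x.1 ∧
    (((α x.2.1 ≤ x.1 + 1 ∨ α x.2.2 ≤ x.1 + 1) ∧ p x.2.2 < p x.2.1) ∨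
      (x.1 + 1 < α x.2.1 ∧ x.1 + 1 < α x.2.2 ∧ e x.2.2 (x.1 + 1) < e x.2.1 (x.1 + 1)))}

theorem inversionSet_finite {m : ℕ} (α : Fin m → ℕ) (p : Fin m → Fin m) (e : Fin m → ℕ → ℕ) :
    (inversionSet α p e).Finite := by
  refine ((Set.finite_Iio (∑ r, α r)).prod (Set.finite_univ (α := Fin m × Fin m))).subset ?_
  rintro ⟨c, r, s⟩ h
  refine ⟨lt_of_lt_of_le h.1 ?_, trivial⟩
  exact Finset.single_le_sum (f := α) (fun _ _ => Nat.zero_le _) (Finset.mem_univ r)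

/-- Only pairs involving row `r₀` need attention. Against a row at least as long, the right
neighbour `N + 1` makes the pair one column earlier an inversion exactly when the smaller entry is
in `r₀`; once `N + 1` is gone, `hlo` puts `r₀` below that row and the position rule gives the same
answer. Against a shorter row the position rule already applied, and `hhi` keeps the order. The
entry `N + 1` can only be the larger of a pair, with the smaller entry below it; by `hp` that row
has length exactly `α r₀`. -/
theorem inversionSet_setEntry_max {m N : ℕ} {α : Fin m → ℕ} {p p' : Fin m → Fin m} {r₀ : Fin m}
    {f : Fin m → ℕ → ℕ} (hr₀ : 0 < α r₀) (hf : IsStandardFilling N (removeBox α r₀) f)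
    (hp : ∀ r s, p r < p s → α s ≤ α r)
    (hpp : ∀ r s, r ≠ r₀ → s ≠ r₀ → (p' r < p' s ↔ p r < p s))
    (hlo : ∀ s, s ≠ r₀ → α r₀ ≤ α s → p' s < p' r₀)
    (hhi : ∀ s, α s < α r₀ → p r₀ < p s ∧ p' r₀ < p' s) :
    inversionSet α p (setEntry f r₀ (α r₀ - 1) (N + 1)) =
      inversionSet (removeBox α r₀) p' f ∪
        (fun s => (α r₀ - 1, s, r₀)) '' {s | p r₀ < p s ∧ α s = α r₀} := by
  have hle := hf.le
  obtain ⟨l, hl⟩ : ∃ l, α r₀ = l + 1 := ⟨α r₀ - 1, by omega⟩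
  have hb : removeBox α r₀ r₀ = l := by rw [removeBox_self]; omega
  have hl' : α r₀ - 1 = l := by omega
  ext ⟨c, r, s⟩
  simp only [inversionSet, Set.mem_ofPred_eq, Set.mem_union, Set.mem_image, Prod.mk.injEq, hl']
  have hex : (∃ x, (p r₀ < p x ∧ α x = α r₀) ∧ l = c ∧ x = r ∧ r₀ = s) ↔
      (p r₀ < p r ∧ α r = α r₀) ∧ l = c ∧ r₀ = s := by
    constructor
    · rintro ⟨x, h, h', rfl, h''⟩; exact ⟨h, h', h''⟩
    · rintro ⟨h, h', h''⟩; exact ⟨r, h, h', rfl, h''⟩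
  rw [hex]
  clear hex
  have h1 := hle s c
  have h2 := hle s (c + 1)
  have h1' := hle r c
  have h2' := hle r (c + 1)
  by_cases hr : r = r₀ <;> by_cases hs : s = r₀
  · subst hr hs
    omega
  · subst hr
    rw [hb, removeBox_of_ne _ hs, setEntry_of_row_ne _ hs, setEntry_of_row_ne _ hs]
    simp only [Ne.symm hs, and_false, or_false]
    have h3 : α s ≤ l → p r < p s ∧ p' r < p' s := fun h => hhi s (by omega)
    have h4 : l < α s → p' s < p' r := fun h => hlo s hs (by omega)
    rcases lt_trichotomy c l with hc | rfl | hc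
    · rw [setEntry_of_col_ne _ hc.ne]
      by_cases hc' : c + 1 = l
      · subst hc'
        rw [setEntry_self]
        omega
      · rw [setEntry_of_col_ne _ hc']
        omega
    · rw [setEntry_self]
      omega
    · omega
  · subst hs
    rw [hb, removeBox_of_ne _ hr, setEntry_of_row_ne _ hr, setEntry_of_row_ne _ hr]
    have h3 : α r ≤ l → p s < p r ∧ p' s < p' r := fun h => hhi r (by omega)
    have h4 : l < α r → p' r < p' s := fun h => hlo r hr (by omega)
    -- Needed in the column of `N + 1`: a row below `r₀` that reaches this column is no longer than
    -- `r₀`, hence equally long.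
    have h5 := hp s r
    rcases lt_trichotomy c l with hc | rfl | hc
    · rw [setEntry_of_col_ne _ hc.ne]
      by_cases hc' : c + 1 = l
      · subst hc'
        rw [setEntry_self]
        omega
      · rw [setEntry_of_col_ne _ hc']
        omega
    · rw [setEntry_self]
      omega
    · omega
  · rw [removeBox_of_ne _ hr, removeBox_of_ne _ hs]
    simp only [setEntry_of_row_ne _ hr, setEntry_of_row_ne _ hs, hpp s r hs hr, Ne.symm hs,
      and_false, or_false]

theorem ncard_inversionSet_setEntry_max {m N : ℕ} {α : Fin m → ℕ} {p p' : Fin m → Fin m}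
    {r₀ : Fin m} {f : Fin m → ℕ → ℕ} (hr₀ : 0 < α r₀)
    (hf : IsStandardFilling N (removeBox α r₀) f)
    (hp : ∀ r s, p r < p s → α s ≤ α r)
    (hpp : ∀ r s, r ≠ r₀ → s ≠ r₀ → (p' r < p' s ↔ p r < p s))
    (hlo : ∀ s, s ≠ r₀ → α r₀ ≤ α s → p' s < p' r₀)
    (hhi : ∀ s, α s < α r₀ → p r₀ < p s ∧ p' r₀ < p' s) :
    (inversionSet α p (setEntry f r₀ (α r₀ - 1) (N + 1))).ncard =
      {s | p r₀ < p s ∧ α s = α r₀}.ncard + (inversionSet (removeBox α r₀) p' f).ncard := by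
  rw [inversionSet_setEntry_max hr₀ hf hp hpp hlo hhi, Set.ncard_union_eq _
    (inversionSet_finite _ _ _) (Set.toFinite _), Set.ncard_image_of_injective, add_comm]
  · intro s t h
    simpa using h
  · rw [Set.disjoint_right]
    rintro _ ⟨s, -, rfl⟩ h
    -- The smaller diagram has no cell of row `r₀` in this column.
    have h2 := h.2.1
    simp only [removeBox_self, lt_irrefl] at h2

/-! ### The recursion for the inversion generating function -/

theorem qNumber_succ (p : ℕ) : qNumber (p + 1) = qNumber p + Polynomial.X ^ p :=
  Finset.sum_range_succ _ _

/-- The numbers of elements above a given one are `0, …, S.card - 1`, each taken once. Applied to a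
block of equally long rows, this produces the `q`-number. -/
theorem sum_X_pow_card_filter_lt {ι : Type*} [LinearOrder ι] (S : Finset ι) :
    ∑ a ∈ S, (Polynomial.X : ℤ[X]) ^ (S.filter fun b => a < b).card = qNumber S.card := by
  induction S using Finset.induction_on_min with
  | empty => simp [qNumber]
  | insert a s ha ih =>
    have hn : a ∉ s := fun h => lt_irrefl _ (ha a h)
    rw [Finset.sum_insert hn, Finset.card_insert_of_notMem hn, qNumber_succ, ← ih, add_comm]
    congr 1
    · refine Finset.sum_congr rfl fun b hb => ?_
      rw [Finset.filter_insert, if_neg (ha b hb).asymm]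
    · rw [Finset.filter_insert, if_neg (lt_irrefl a), Finset.filter_true_of_mem ha]

theorem Fin.exists_perm_shift {m : ℕ} {q b : Fin m} (hqb : q ≤ b) :
    ∃ σ : Equiv.Perm (Fin m), σ q = b ∧ (∀ k, k < q → σ k = k) ∧ (∀ k, b < k → σ k = k) ∧
      ∀ k, q < k → k ≤ b → (σ k : ℕ) + 1 = k := by
  have : NeZero m := ⟨by rintro rfl; exact q.elim0⟩
  refine ⟨(Fin.cycleIcc q b).symm, ?_, ?_, ?_, ?_⟩
  · rw [Equiv.symm_apply_eq, Fin.cycleIcc_of_last hqb]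
  · intro k hk
    rw [Equiv.symm_apply_eq, Fin.cycleIcc_of_lt hk]
  · intro k hk
    rw [Equiv.symm_apply_eq, Fin.cycleIcc_of_gt hk]
  · intro k hk hkb
    have hk' : (q : ℕ) < k := hk
    have hkb' : (k : ℕ) ≤ b := hkb
    obtain ⟨j, hj⟩ : ∃ j : Fin m, (j : ℕ) + 1 = k := ⟨⟨k - 1, by omega⟩, by simp; omega⟩
    have h1 : Fin.cycleIcc q b j = k := by
      rw [Fin.cycleIcc_of_ge_of_lt (by rw [Fin.le_def]; omega) (by rw [Fin.lt_def]; omega)]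
      ext
      rw [Fin.val_add_one_of_lt' (by omega), hj]
    rw [← h1, Equiv.symm_apply_apply, h1, hj]

/-- Row `b` is the last row of its length in `lam`, and is not empty. -/
def IsCornerRow {m : ℕ} (lam : Fin m → ℕ) (b : Fin m) : Prop :=
  0 < lam b ∧ ∀ k, b < k → lam k < lam b

theorem IsCornerRow.antitone_removeBox {m : ℕ} {lam : Fin m → ℕ} {b : Fin m}
    (h : IsCornerRow lam b) (hlam : Antitone lam) : Antitone (removeBox lam b) := by
  intro i j hij
  have h1 := hlam hij
  by_cases hi : i = b <;> by_cases hj : j = b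
  · rw [hi, hj]
  · subst hi
    rw [removeBox_self, removeBox_of_ne _ hj]
    have := h.2 j (lt_of_le_of_ne hij (Ne.symm hj))
    omega
  · subst hj
    rw [removeBox_self, removeBox_of_ne _ hi]
    omega
  · rwa [removeBox_of_ne _ hi, removeBox_of_ne _ hj]

theorem exists_isCornerRow {m : ℕ} {lam : Fin m → ℕ} (hlam : Antitone lam) {q : Fin m}
    (hq : 0 < lam q) : ∃ b, q ≤ b ∧ lam b = lam q ∧ IsCornerRow lam b := by
  obtain ⟨b, hb, hmax⟩ := Finset.exists_max_image (Finset.univ.filter fun k => lam k = lam q) id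
    ⟨q, by simp⟩
  simp only [Finset.mem_filter, Finset.mem_univ, true_and, id] at hb hmax
  refine ⟨b, hmax q rfl, hb, by omega, fun k hk => lt_of_le_of_ne (hlam hk.le) fun h => ?_⟩
  exact absurd (hmax k (h.trans hb)) (not_le_of_gt hk)

open Classical in
/-- The weighted number of ways to build the partition `lam` of `N` by adding boxes: adding
a box to row `b` has weight `[p]_q`, with `p` the number of rows which are then as long as `b`. -/
noncomputable def weightedChains {m : ℕ} : ℕ → (Fin m → ℕ) → ℤ[X]
  | 0, lam => if lam = 0 then 1 else 0
  | N + 1, lam => ∑ b with IsCornerRow lam b,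
      qNumber (Finset.univ.filter fun l => lam l = lam b).card * weightedChains N (removeBox lam b)

/-- The new heights come from moving row `r₀` down to position `b` and shifting the rows in between
up by one. Those rows all have length `lam b`, so the shift does not change the lengths read from
top to bottom. The last three conjuncts are the conditions on heights in
`inversionSet_setEntry_max`. -/
theorem exists_perm_removeBox {m : ℕ} {lam : Fin m → ℕ} (hlam : Antitone lam)
    (π : Equiv.Perm (Fin m)) {r₀ b : Fin m} (hqb : π r₀ ≤ b) (hb : lam b = lam (π r₀))
    (hc : IsCornerRow lam b) :
    ∃ π' : Equiv.Perm (Fin m), removeBox (lam ∘ π) r₀ = removeBox lam b ∘ π' ∧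
      (∀ r s, r ≠ r₀ → s ≠ r₀ → (π' r < π' s ↔ π r < π s)) ∧
      (∀ s, s ≠ r₀ → lam (π r₀) ≤ lam (π s) → π' s < π' r₀) ∧
      (∀ s, lam (π s) < lam (π r₀) → π r₀ < π s ∧ π' r₀ < π' s) := by
  obtain ⟨σ, h1, h2, h3, h4⟩ := Fin.exists_perm_shift hqb
  have hval : ∀ k, k ≠ π r₀ → (k < π r₀ ∧ (σ k : ℕ) = k) ∨ (b < k ∧ (σ k : ℕ) = k) ∨
      (π r₀ < k ∧ k ≤ b ∧ (σ k : ℕ) + 1 = k) := by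
    intro k hk
    have h2 := h2 k
    have h3 := h3 k
    have h4 := h4 k
    rcases lt_trichotomy k (π r₀) with h | h | h
    · exact Or.inl ⟨h, by rw [h2 h]⟩
    · exact absurd h hk
    · rcases le_or_gt k b with h' | h'
      · exact Or.inr (Or.inr ⟨h, h', h4 h h'⟩)
      · exact Or.inr (Or.inl ⟨h', by rw [h3 h']⟩)
  refine ⟨σ * π, ?_, ?_, ?_, ?_⟩
  · funext s
    rw [Function.comp_apply, Equiv.Perm.mul_apply]
    by_cases hs : s = r₀
    · subst hs
      rw [h1, removeBox_self, removeBox_self, hb, Function.comp_apply]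
    · have hne : π s ≠ π r₀ := fun h => hs (π.injective h)
      have hne' : σ (π s) ≠ b := fun h => hne (σ.injective (h.trans h1.symm))
      rw [removeBox_of_ne _ hs, removeBox_of_ne _ hne', Function.comp_apply]
      rcases hval _ hne with ⟨h, h'⟩ | ⟨h, h'⟩ | ⟨h, h5, h'⟩
      · rw [Fin.ext h']
      · rw [Fin.ext h']
      · have k1 := hlam h.le
        have k2 := hlam h5
        have k3 : lam b ≤ lam (σ (π s)) := hlam (by rw [Fin.le_def] at h5 ⊢; omega)
        have k4 : lam (σ (π s)) ≤ lam (π r₀) := hlam (by rw [Fin.lt_def] at h; rw [Fin.le_def]; omega)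
        omega
  · intro r s hr hs
    have hr' := hval (π r) fun h => hr (π.injective h)
    have hs' := hval (π s) fun h => hs (π.injective h)
    -- Covers `r = s`, since `omega` treats the two values of `σ` as unrelated atoms.
    have hrs : π r = π s → (σ (π r) : ℕ) = σ (π s) := fun h => by rw [h]
    simp only [Equiv.Perm.mul_apply]
    omega
  · intro s hs h
    have hs' := hval (π s) fun h => hs (π.injective h)
    have hbs : π s ≤ b := by
      by_contra h'
      have := hc.2 (π s) (not_le.1 h')
      omega
    simp only [Equiv.Perm.mul_apply, h1]
    omega
  · intro s hs
    have hbs : b < π s := by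
      by_contra h'
      have := hlam (not_lt.1 h')
      omega
    simp only [Equiv.Perm.mul_apply, h1, h3 _ hbs]
    exact ⟨lt_of_le_of_lt hqb hbs, hbs⟩

/-- The arbitrary `π` is what makes the induction close, because deleting the largest entry changes
the heights of the rows. The fillings of the partition itself are the case of the identity. -/
theorem sum_X_pow_ncard_inversionSet {m : ℕ} (N : ℕ) {lam : Fin m → ℕ} (hlam : Antitone lam)
    (π : Equiv.Perm (Fin m)) :
    ∑ e ∈ standardFillings N (lam ∘ π), (Polynomial.X : ℤ[X]) ^ (inversionSet (lam ∘ π) π e).ncard =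
      weightedChains N lam := by
  classical
  induction N generalizing lam π with
  | zero =>
    have h0 : lam ∘ π = 0 ↔ lam = 0 := by
      constructor
      · intro h; funext k; simpa using congrFun h (π.symm k)
      · rintro rfl; rfl
    rw [standardFillings, weightedChains]
    by_cases h : lam = 0
    · subst h
      have he : inversionSet ((0 : Fin m → ℕ) ∘ π) π 0 = ∅ := by
        ext x; simp [inversionSet]
      rw [if_pos (h0.2 rfl), if_pos rfl, Finset.sum_singleton, he, Set.ncard_empty, pow_zero]
    · rw [if_neg (mt h0.1 h), if_neg h, Finset.sum_empty]
  | succ N ih =>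
    choose! last hlast using fun (q : Fin m) (hq : 0 < lam q) => exists_isCornerRow hlam hq
    have hstep : ∀ r ∈ Finset.univ.filter (fun r => 0 < (lam ∘ π) r),
        ∑ f ∈ standardFillings N (removeBox (lam ∘ π) r),
          (Polynomial.X : ℤ[X]) ^
            (inversionSet (lam ∘ π) π (setEntry f r ((lam ∘ π) r - 1) (N + 1))).ncard =
        Polynomial.X ^ (Finset.univ.filter fun k => π r < k ∧ lam k = lam (π r)).card *
          weightedChains N (removeBox lam (last (π r))) := by
      intro r hr
      simp only [Finset.mem_filter, Finset.mem_univ, true_and] at hr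
      obtain ⟨hq, hb, hc⟩ := hlast (π r) hr
      obtain ⟨π', h1, h2, h3, h4⟩ := exists_perm_removeBox hlam π hq hb hc
      have hcard : {s | π r < π s ∧ (lam ∘ π) s = (lam ∘ π) r}.ncard =
          (Finset.univ.filter fun k => π r < k ∧ lam k = lam (π r)).card := by
        rw [← Set.ncard_coe_finset, ← Set.ncard_image_of_injective _ π.injective]
        congr 1
        ext k
        simp only [Set.mem_image, Set.mem_ofPred_eq, Finset.coe_filter, Finset.mem_univ, true_and]
        constructor
        · rintro ⟨s, hs, rfl⟩; exact hs
        · intro hk; exact ⟨π.symm k, by simpa using hk, by simp⟩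
      rw [← ih (hc.antitone_removeBox hlam) π', Finset.mul_sum, ← h1]
      refine Finset.sum_congr rfl fun f hf => ?_
      rw [ncard_inversionSet_setEntry_max hr ((mem_standardFillings _ _ _).1 hf)
        (fun r s h => hlam h.le) h2 h3 h4, pow_add, hcard]
    rw [sum_standardFillings_succ, Finset.sum_congr rfl hstep, weightedChains]
    rw [Finset.sum_equiv π (t := Finset.univ.filter fun q => 0 < lam q)
      (g := fun q => Polynomial.X ^ (Finset.univ.filter fun k => q < k ∧ lam k = lam q).card *
          weightedChains N (removeBox lam (last q))) (by simp) (fun _ _ => rfl)]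
    -- The remaining partition depends only on the bottom row `last q` of the block of `q`, so the
    -- sum is grouped by blocks.
    rw [← Finset.sum_fiberwise_of_maps_to (g := last)
      (t := Finset.univ.filter fun b => IsCornerRow lam b)
      (by intro q hq; simpa using (hlast q (by simpa using hq)).2.2)]
    refine Finset.sum_congr rfl fun b hb => ?_
    have hb' : IsCornerRow lam b := by simpa using hb
    have hfib : (Finset.univ.filter fun q => 0 < lam q).filter (fun q => last q = b) =
        Finset.univ.filter fun l => lam l = lam b := by
      ext q
      simp only [Finset.mem_filter, Finset.mem_univ, true_and]
      constructor
      · rintro ⟨hq, rfl⟩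
        exact (hlast q hq).2.1.symm
      · intro hq
        have hq0 : 0 < lam q := hq ▸ hb'.1
        obtain ⟨k1, k2, k3⟩ := hlast q hq0
        refine ⟨hq0, ?_⟩
        -- Two corner rows of the same length coincide, since everything below a corner row is
        -- strictly shorter.
        rcases lt_trichotomy (last q) b with h | h | h
        · have := k3.2 b h; omega
        · exact h
        · have := hb'.2 _ h; omega
    rw [hfib, ← sum_X_pow_card_filter_lt, Finset.sum_mul]
    refine Finset.sum_congr rfl fun q hq => ?_
    simp only [Finset.mem_filter, Finset.mem_univ, true_and] at hq
    have hlq : last q = b := by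
      have : q ∈ (Finset.univ.filter fun q => 0 < lam q).filter (fun q => last q = b) := by
        rw [hfib]; simpa using hq
      exact (Finset.mem_filter.1 this).2
    rw [hlq, Finset.filter_filter, hq]
    simp only [and_comm]

/-! ### Weighted Dyck paths -/

/-- The step from `u` to `v` ends in a return to ground of degree `d`. -/
def IsReturnStep {m : ℕ} (u v : Fin m → ℤ) (d : ℕ) : Prop :=
  ∃ g : Fin m, v = u + Pi.single g 1 ∧ d ≤ (g : ℕ) ∧
    (∀ l : Fin m, (g : ℕ) ≤ l + d → l ≤ g → v l = v g) ∧
    (∀ l : Fin m, (l : ℕ) + d + 1 = g → v l ≠ v g)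

open Classical in
/-- The product of `[d + 1]_q` over the positive degrees `d` of the returns to ground at the end
of the step from `u` to `v`. -/
noncomputable def stepWeight {m : ℕ} (u v : Fin m → ℤ) : ℤ[X] :=
  ∏ j : Fin (m - 1), if IsReturnStep u v (j + 1) then qNumber (j + 2) else 1

theorem eq_of_add_single_eq {m : ℕ} {u : Fin m → ℤ} {g b : Fin m}
    (h : u + Pi.single g 1 = u + Pi.single b 1) : g = b := by
  have h1 := congrFun (add_left_cancel h) b
  by_contra hgb
  simp [Ne.symm hgb] at h1

theorem castRemoveBox_add_single {m : ℕ} {lam : Fin m → ℕ} {b : Fin m} (hb : 0 < lam b) :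
    (fun i => (lam i : ℤ)) = (fun i => (removeBox lam b i : ℤ)) + Pi.single b 1 := by
  funext i
  rw [Pi.add_apply]
  by_cases hi : i = b
  · subst hi
    rw [removeBox_self, Pi.single_eq_same]
    omega
  · rw [removeBox_of_ne _ hi, Pi.single_eq_of_ne hi, add_zero]

/-- The coordinates equal to `lam b` form an interval from `a` to `b`. The two conditions on a
return of degree `d` say that the interval reaches back to `b - d` and no further. -/
theorem isReturnStep_removeBox_iff {m : ℕ} {lam : Fin m → ℕ} (hlam : Antitone lam) {b : Fin m}
    (hb : IsCornerRow lam b) (d : ℕ) :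
    IsReturnStep (fun i => (removeBox lam b i : ℤ)) (fun i => (lam i : ℤ)) d ↔
      (Finset.univ.filter fun l => lam l = lam b).card = d + 1 := by
  have hstep := castRemoveBox_add_single hb.1
  obtain ⟨a, ha, hmin⟩ := Finset.exists_min_image (Finset.univ.filter fun k => lam k = lam b) id
    ⟨b, by simp⟩
  simp only [Finset.mem_filter, Finset.mem_univ, true_and, id] at ha hmin
  have hab : a ≤ b := hmin b rfl
  have hgroup : (Finset.univ.filter fun l => lam l = lam b) = Finset.Icc a b := by
    ext l
    simp only [Finset.mem_filter, Finset.mem_univ, true_and, Finset.mem_Icc]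
    constructor
    · intro h
      refine ⟨hmin l h, ?_⟩
      by_contra hl
      have := hb.2 l (not_le.1 hl)
      omega
    · rintro ⟨h1, h2⟩
      have := hlam h1
      have := hlam h2
      omega
  rw [hgroup, Fin.card_Icc]
  have hab' : (a : ℕ) ≤ b := hab
  constructor
  · rintro ⟨g, hg, hd, hin, hout⟩
    obtain rfl : g = b := eq_of_add_single_eq (hg.symm.trans hstep)
    have h1 : (g : ℕ) - d ≥ a := by
      have := hmin ⟨g - d, by omega⟩ (by
        have := hin ⟨g - d, by omega⟩ (by simp only; omega) (by rw [Fin.le_def]; simp only; omega)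
        exact Nat.cast_inj.1 this)
      exact this
    have h2 : (g : ℕ) - d ≤ a := by
      by_contra h
      have h3 : lam ⟨g - d - 1, by omega⟩ = lam g := by
        have k1 := hlam (show a ≤ ⟨g - d - 1, by omega⟩ by rw [Fin.le_def]; simp only; omega)
        have k2 := hlam (show (⟨g - d - 1, by omega⟩ : Fin m) ≤ g by
          rw [Fin.le_def]; simp only; omega)
        omega
      exact hout ⟨g - d - 1, by omega⟩ (by simp only; omega) (congrArg Nat.cast h3)
    omega
  · intro h
    have hd : (a : ℕ) + d = b := by omega
    refine ⟨b, hstep, by omega, ?_, ?_⟩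
    · intro l h1 h2
      have h3 := hlam h2
      have h4 : lam l ≤ lam a := hlam (by rw [Fin.le_def]; omega)
      have : lam l = lam b := by omega
      exact congrArg Nat.cast this
    · intro l h1 h2
      have h3 : lam l = lam b := Nat.cast_inj.1 h2
      have : (a : ℕ) ≤ l := hmin l h3
      omega

theorem stepWeight_removeBox {m : ℕ} {lam : Fin m → ℕ} (hlam : Antitone lam) {b : Fin m}
    (hb : IsCornerRow lam b) :
    stepWeight (fun i => (removeBox lam b i : ℤ)) (fun i => (lam i : ℤ)) =
      qNumber (Finset.univ.filter fun l => lam l = lam b).card := by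
  classical
  have hpos : 0 < (Finset.univ.filter fun l => lam l = lam b).card :=
    Finset.card_pos.2 ⟨b, by simp⟩
  have hle : (Finset.univ.filter fun l => lam l = lam b).card ≤ m := by
    simpa using Finset.card_le_univ (Finset.univ.filter fun l => lam l = lam b)
  unfold stepWeight
  simp only [isReturnStep_removeBox_iff hlam hb]
  generalize (Finset.univ.filter fun l => lam l = lam b).card = k at *
  by_cases hk : k = 1
  · subst hk
    rw [Finset.prod_eq_one]
    · simp [qNumber]
    · intro j _
      rw [if_neg (by omega)]
  -- The index `j` stands for degree `j + 1`, and the degree here is `k - 1`.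
  · rw [Finset.prod_eq_single ⟨k - 2, by omega⟩]
    · rw [if_pos (by simp only; omega)]
      congr 1
      simp only
      omega
    · intro j _ hj
      rw [if_neg]
      intro h
      apply hj
      ext
      simp only
      omega
    · simp

/-- `v` is a Dyck path with `N` steps and endpoint `lam`. -/
structure IsDyckPath {m : ℕ} (N : ℕ) (lam : Fin m → ℕ) (v : Fin (N + 1) → Fin m → ℤ) : Prop where
  zero : v 0 = 0
  last : v (Fin.last N) = fun i => (lam i : ℤ)
  step : ∀ t : Fin N, ∃ j, v t.succ = v t.castSucc + Pi.single j 1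
  antitone : ∀ t, Antitone (v t)

theorem IsDyckPath.nonneg {m N : ℕ} {lam : Fin m → ℕ} {v : Fin (N + 1) → Fin m → ℤ}
    (h : IsDyckPath N lam v) (t : Fin (N + 1)) (i : Fin m) : 0 ≤ v t i := by
  induction t using Fin.induction with
  | zero => rw [h.zero, Pi.zero_apply]
  | succ t ih =>
    obtain ⟨j, hj⟩ := h.step t
    rw [hj, Pi.add_apply, Pi.single_apply]
    split_ifs <;> omega

theorem IsDyckPath.snoc {m N : ℕ} {lam : Fin m → ℕ} (hlam : Antitone lam) {b : Fin m}
    (hb : IsCornerRow lam b) {w : Fin (N + 1) → Fin m → ℤ}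
    (hw : IsDyckPath N (removeBox lam b) w) :
    IsDyckPath (N + 1) lam (Fin.snoc (α := fun _ => Fin m → ℤ) w fun i => (lam i : ℤ)) := by
  constructor
  · rw [← Fin.castSucc_zero, Fin.snoc_castSucc, hw.zero]
  · rw [Fin.snoc_last]
  · intro t
    induction t using Fin.lastCases with
    | last =>
      refine ⟨b, ?_⟩
      rw [Fin.succ_last, Fin.snoc_last, Fin.snoc_castSucc, hw.last]
      exact castRemoveBox_add_single hb.1
    | cast t =>
      rw [Fin.succ_castSucc, Fin.snoc_castSucc, Fin.snoc_castSucc]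
      exact hw.step t
  · intro t
    induction t using Fin.lastCases with
    | last =>
      rw [Fin.snoc_last]
      intro i j hij
      exact Nat.cast_le.2 (hlam hij)
    | cast t =>
      rw [Fin.snoc_castSucc]
      exact hw.antitone t

theorem IsDyckPath.exists_snoc {m N : ℕ} {lam : Fin m → ℕ} {v : Fin (N + 2) → Fin m → ℤ}
    (hv : IsDyckPath (N + 1) lam v) :
    ∃ b, IsCornerRow lam b ∧ ∃ w, IsDyckPath N (removeBox lam b) w ∧
      Fin.snoc (α := fun _ => Fin m → ℤ) w (fun i => (lam i : ℤ)) = v := by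
  obtain ⟨b, hb⟩ := hv.step (Fin.last N)
  rw [Fin.succ_last, hv.last] at hb
  have hself : (lam b : ℤ) = v (Fin.last N).castSucc b + 1 := by
    simpa using congrFun hb b
  have hne : ∀ i, i ≠ b → (lam i : ℤ) = v (Fin.last N).castSucc i := by
    intro i hi
    simpa [Pi.single_eq_of_ne hi] using congrFun hb i
  have h0 := hv.nonneg (Fin.last N).castSucc b
  refine ⟨b, ⟨by omega, ?_⟩, Fin.init v, ⟨?_, ?_, ?_, ?_⟩, ?_⟩
  · intro k hk
    -- The point before the last step is still weakly decreasing, so before the final increment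
    -- coordinate `b` was already at least every later one.
    have h1 := hv.antitone (Fin.last N).castSucc hk.le
    have h2 := hne k hk.ne'
    omega
  · exact hv.zero
  · funext i
    by_cases hi : i = b
    · subst hi
      rw [removeBox_self]
      change v (Fin.last N).castSucc i = _
      omega
    · rw [removeBox_of_ne _ hi]
      exact (hne i hi).symm
  · intro t
    exact hv.step t.castSucc
  · intro t
    exact hv.antitone t.castSucc
  · rw [← hv.last]
    exact Fin.snoc_init_self v

open Classical in
/-- The Dyck paths with `N` steps and endpoint `lam`, built by adding the last step. -/
noncomputable def dyckPaths {m : ℕ} : (N : ℕ) → (Fin m → ℕ) → Finset (Fin (N + 1) → Fin m → ℤ)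
  | 0, lam => if lam = 0 then {0} else ∅
  | N + 1, lam => (Finset.univ.filter fun b => IsCornerRow lam b).biUnion fun b =>
      (dyckPaths N (removeBox lam b)).image fun w =>
        Fin.snoc (α := fun _ => Fin m → ℤ) w fun i => (lam i : ℤ)

theorem mem_dyckPaths {m N : ℕ} {lam : Fin m → ℕ} (hlam : Antitone lam)
    (v : Fin (N + 1) → Fin m → ℤ) : v ∈ dyckPaths N lam ↔ IsDyckPath N lam v := by
  induction N generalizing lam with
  | zero =>
    rw [dyckPaths]
    constructor
    · intro h
      split_ifs at h with h0
      · subst h0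
        rw [Finset.mem_singleton] at h
        subst h
        refine ⟨rfl, by funext; simp, fun t => t.elim0, fun t i j _ => le_rfl⟩
      · simp at h
    · intro h
      have h0 : lam = 0 := by
        funext i
        have := congrFun (h.last.symm.trans h.zero) i
        simpa using this
      rw [if_pos h0, Finset.mem_singleton]
      funext t
      rw [Fin.fin_one_eq_zero t, h.zero]
      rfl
  | succ N ih =>
    simp only [dyckPaths, Finset.mem_biUnion, Finset.mem_filter, Finset.mem_univ, true_and,
      Finset.mem_image]
    constructor
    · rintro ⟨b, hb, w, hw, rfl⟩
      exact ((ih (hb.antitone_removeBox hlam) w).1 hw).snoc hlam hb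
    · intro h
      obtain ⟨b, hb, w, hw, rfl⟩ := h.exists_snoc
      exact ⟨b, hb, w, (ih (hb.antitone_removeBox hlam) w).2 hw, rfl⟩

theorem sum_prod_stepWeight {m N : ℕ} {lam : Fin m → ℕ} (hlam : Antitone lam) :
    ∑ v ∈ dyckPaths N lam, ∏ t : Fin N, stepWeight (v t.castSucc) (v t.succ) =
      weightedChains N lam := by
  classical
  induction N generalizing lam with
  | zero =>
    rw [dyckPaths, weightedChains]
    split_ifs <;> simp
  | succ N ih =>
    rw [dyckPaths, weightedChains, Finset.sum_biUnion]
    · refine Finset.sum_congr rfl fun b hb => ?_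
      have hb' : IsCornerRow lam b := by simpa using hb
      have hanti := hb'.antitone_removeBox hlam
      rw [Finset.sum_image, ← ih hanti, Finset.mul_sum]
      · refine Finset.sum_congr rfl fun w hw => ?_
        have hw' := (mem_dyckPaths hanti w).1 hw
        rw [Fin.prod_univ_castSucc, Fin.succ_last, Fin.snoc_last, Fin.snoc_castSucc, hw'.last,
          stepWeight_removeBox hlam hb', mul_comm]
        simp only [Fin.succ_castSucc, Fin.snoc_castSucc]
      · intro w _ w' _ h
        funext t
        simpa using congrFun h t.castSucc
    · intro b hb b' hb' hbb
      have hb : IsCornerRow lam b := by simpa using hb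
      have hb' : IsCornerRow lam b' := by simpa using hb'
      rw [Function.onFun, Finset.disjoint_left]
      simp only [Finset.mem_image]
      rintro _ ⟨w, hw, rfl⟩ ⟨w', hw', h⟩
      have hw := (mem_dyckPaths (hb.antitone_removeBox hlam) w).1 hw
      have hw' := (mem_dyckPaths (hb'.antitone_removeBox hlam) w').1 hw'
      have h1 : w' (Fin.last N) = w (Fin.last N) := by
        simpa using congrFun h (Fin.last N).castSucc
      rw [hw.last, hw'.last] at h1
      -- Different last coordinates give different penultimate points: at `b` one has `lam b - 1`,
      -- the other `lam b`.
      have h2 := congrFun h1 b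
      simp only [removeBox_self, removeBox_of_ne lam hbb] at h2
      have := hb.1
      omega

/-! ### The two sides of the identity -/

/-- Turns a generating function indexed by the values of a statistic into a sum over the objects,
where the recursions apply. Values that are not attained contribute zero, so the support is finite.
-/
theorem finsum_ncard_fiber_mul {ι κ : Type*} [Fintype ι] (P : ι → Prop) [DecidablePred P]
    (f : ι → κ) (g : κ → ℤ[X]) :
    ∑ᶠ k, ((({x | P x ∧ f x = k} : Set ι).ncard : ℕ) : ℤ[X]) * g k = ∑ x with P x, g (f x) := by
  classical
  have hcard : ∀ k, ({x | P x ∧ f x = k} : Set ι).ncard =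
      ((Finset.univ.filter P).filter fun x => f x = k).card := by
    intro k
    rw [← Set.ncard_coe_finset]
    congr 1
    ext x
    simp
  rw [finsum_eq_sum_of_support_subset (s := (Finset.univ.filter P).image f)]
  · rw [← Finset.sum_fiberwise_of_maps_to (g := f) (t := (Finset.univ.filter P).image f)
      (fun x hx => Finset.mem_image_of_mem f hx)]
    refine Finset.sum_congr rfl fun k _ => ?_
    rw [hcard, Finset.sum_congr rfl fun x hx => by rw [(Finset.mem_filter.1 hx).2],
      Finset.sum_const, nsmul_eq_mul]
  · intro k hk
    by_contra hk'
    apply hk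
    beta_reduce
    rw [hcard, Finset.filter_false_of_mem]
    · simp
    · rintro x hx rfl
      exact hk' (Finset.mem_coe.2 (Finset.mem_image_of_mem f hx))

theorem YoungDiagram.lt_colLen_zero {Y : YoungDiagram} {r c : ℕ} (h : (r, c) ∈ Y) :
    r < Y.colLen 0 :=
  YoungDiagram.mem_iff_lt_colLen.1 (Y.up_left_mem le_rfl (Nat.zero_le c) h)

theorem card_cells_eq_sum_shapeTuple (Y : YoungDiagram) :
    Y.cells.card = ∑ i, shapeTuple Y i := by
  rw [Finset.card_eq_sum_card_fiberwise (f := Prod.fst) (t := Finset.range (Y.colLen 0)),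
    Finset.sum_range]
  · exact Finset.sum_congr rfl fun i _ => (YoungDiagram.rowLen_eq_card Y).symm
  · rintro ⟨r, c⟩ h
    simpa using YoungDiagram.lt_colLen_zero ((YoungDiagram.mem_cells _).1 h)

theorem antitone_shapeTuple (Y : YoungDiagram) : Antitone (shapeTuple Y) :=
  fun i j hij => Y.rowLen_anti i j hij

namespace RowStandardFilling

variable {Y : YoungDiagram}

/-- The entries of a filling as a function on the rows of the diagram. -/
def rowEntries (τ : RowStandardFilling Y) : Fin (Y.colLen 0) → ℕ → ℕ := fun r c => τ.entry r c

theorem rowEntries_injective : Function.Injective (rowEntries (Y := Y)) := by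
  intro τ σ h
  ext r c
  by_cases hm : (r, c) ∈ Y
  · exact congrFun (congrFun h ⟨r, YoungDiagram.lt_colLen_zero hm⟩) c
  · rw [τ.zeros r c hm, σ.zeros r c hm]

/-- The entries are as many distinct numbers in `1, …, Y.cells.card` as there are cells, so they
exhaust this interval. -/
theorem NoRepeats.exists_entry_eq {τ : RowStandardFilling Y} (h : τ.NoRepeats) {v : ℕ}
    (hv : 0 < v) (hle : v ≤ Y.cells.card) : ∃ r c, (r, c) ∈ Y ∧ τ.entry r c = v := by
  have hinj : Set.InjOn (fun p : ℕ × ℕ => τ.entry p.1 p.2) Y.cells := by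
    rintro ⟨r, c⟩ hr ⟨s, d⟩ hs he
    have := h r c s d ((YoungDiagram.mem_cells _).1 hr) ((YoungDiagram.mem_cells _).1 hs) he
    rw [this.1, this.2]
  have himg : Y.cells.image (fun p : ℕ × ℕ => τ.entry p.1 p.2) = Finset.Icc 1 Y.cells.card := by
    apply Finset.eq_of_subset_of_card_le
    · intro w hw
      obtain ⟨⟨r, c⟩, hr, rfl⟩ := Finset.mem_image.1 hw
      exact Finset.mem_Icc.2 ⟨τ.pos r c ((YoungDiagram.mem_cells _).1 hr), τ.entry_le_card r c⟩
    · rw [Finset.card_image_of_injOn hinj, Nat.card_Icc]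
      omega
  have hmem : v ∈ Y.cells.image (fun p : ℕ × ℕ => τ.entry p.1 p.2) := by
    rw [himg, Finset.mem_Icc]; omega
  obtain ⟨⟨r, c⟩, hr, he⟩ := Finset.mem_image.1 hmem
  exact ⟨r, c, (YoungDiagram.mem_cells _).1 hr, he⟩

theorem NoRepeats.isStandardFilling {τ : RowStandardFilling Y} (h : τ.NoRepeats) :
    IsStandardFilling Y.cells.card (shapeTuple Y) τ.rowEntries where
  zeros r c hc := τ.zeros r c fun hm => (YoungDiagram.mem_iff_lt_rowLen.1 hm).not_ge hc
  pos r c hc := τ.pos r c (YoungDiagram.mem_iff_lt_rowLen.2 hc)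
  le r c := τ.entry_le_card r c
  strict r c d hcd hd := τ.row_strict r c d hcd (YoungDiagram.mem_iff_lt_rowLen.2 hd)
  inj r c s d hc hd he := by
    have := h r c s d (YoungDiagram.mem_iff_lt_rowLen.2 hc) (YoungDiagram.mem_iff_lt_rowLen.2 hd) he
    exact ⟨Fin.ext this.1, this.2⟩
  surj v hv hle := by
    obtain ⟨r, c, hm, he⟩ := h.exists_entry_eq hv hle
    exact ⟨⟨r, YoungDiagram.lt_colLen_zero hm⟩, c, YoungDiagram.mem_iff_lt_rowLen.1 hm, he⟩

theorem exists_rowEntries_eq {e : Fin (Y.colLen 0) → ℕ → ℕ}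
    (he : IsStandardFilling Y.cells.card (shapeTuple Y) e) :
    ∃ τ : RowStandardFilling Y, τ.NoRepeats ∧ τ.rowEntries = e := by
  have hmem : ∀ {r c} (h : (r, c) ∈ Y), c < shapeTuple Y ⟨r, YoungDiagram.lt_colLen_zero h⟩ :=
    fun h => YoungDiagram.mem_iff_lt_rowLen.1 h
  let E : ℕ → ℕ → ℕ := fun r c => if h : r < Y.colLen 0 then e ⟨r, h⟩ c else 0
  have hE : ∀ {r} (h : r < Y.colLen 0) c, E r c = e ⟨r, h⟩ c := fun h c => dif_pos h
  refine ⟨⟨E, ?_, ?_, ?_, ?_⟩, ?_, ?_⟩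
  · intro r c h
    by_cases hr : r < Y.colLen 0
    · rw [hE hr]
      exact he.zeros _ _ (not_lt.1 fun hc => h (YoungDiagram.mem_iff_lt_rowLen.2 hc))
    · exact dif_neg hr
  · intro r c h
    rw [hE (YoungDiagram.lt_colLen_zero h)]
    exact he.pos _ _ (hmem h)
  · intro r c h v hv hle
    rw [hE (YoungDiagram.lt_colLen_zero h)] at hle
    obtain ⟨s, d, hd, hs⟩ := he.surj v hv (hle.trans (he.le _ _))
    exact ⟨s, d, YoungDiagram.mem_iff_lt_rowLen.2 hd, by rw [hE s.2, ← hs]⟩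
  · intro r c d hcd h
    rw [hE (YoungDiagram.lt_colLen_zero h), hE (YoungDiagram.lt_colLen_zero h)]
    exact he.strict _ _ _ hcd (hmem h)
  · intro r c s d hr hs heq
    simp only [hE (YoungDiagram.lt_colLen_zero hr), hE (YoungDiagram.lt_colLen_zero hs)] at heq
    have := he.inj _ _ _ _ (hmem hr) (hmem hs) heq
    exact ⟨congrArg Fin.val this.1, this.2⟩
  · funext r c
    exact hE r.2 c

theorem NoRepeats.isInversion_iff {τ : RowStandardFilling Y} (h : τ.NoRepeats) (c r s : ℕ) :
    τ.IsInversion c r s ↔ (r, c) ∈ Y ∧ (s, c) ∈ Y ∧ τ.entry r c < τ.entry s c ∧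
      ((((r, c + 1) ∉ Y ∨ (s, c + 1) ∉ Y) ∧ s < r) ∨
        ((r, c + 1) ∈ Y ∧ (s, c + 1) ∈ Y ∧ τ.entry s (c + 1) < τ.entry r (c + 1))) := by
  unfold IsInversion
  refine and_congr_right fun hr => and_congr_right fun hs => and_congr_right fun hlt => ?_
  constructor
  · rintro ⟨n, hn, h'⟩
    rcases Nat.eq_zero_or_pos n with rfl | hpos
    · exact h'
    · obtain ⟨h1, h2, h3⟩ := hn 1 le_rfl hpos
      -- For `n ≥ 1` equal right neighbours would be a repeated entry unless the two rows coincide;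
      -- so only `n = 0` occurs.
      have := (h _ _ _ _ h1 h2 h3).1
      subst this
      exact absurd hlt (lt_irrefl _)
  · intro h'
    exact ⟨0, fun k h1 h2 => by omega, h'⟩

theorem NoRepeats.inv_eq_ncard {τ : RowStandardFilling Y} (h : τ.NoRepeats) :
    τ.inv = (inversionSet (shapeTuple Y) id τ.rowEntries).ncard := by
  classical
  unfold inv
  rw [← Set.ncard_coe_finset, ← Set.ncard_image_of_injective (inversionSet _ _ _)
    (f := fun x : ℕ × Fin (Y.colLen 0) × Fin (Y.colLen 0) =>
      (((x.2.1 : ℕ), x.1), ((x.2.2 : ℕ), x.1)))]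
  · congr 1
    ext ⟨⟨r, c⟩, ⟨s, d⟩⟩
    simp only [Finset.coe_filter, Finset.mem_product, YoungDiagram.mem_cells, Set.mem_ofPred_eq,
      Set.mem_image, h.isInversion_iff, inversionSet, YoungDiagram.mem_iff_lt_rowLen, not_lt,
      Prod.mk.injEq]
    constructor
    · rintro ⟨⟨h1, h2⟩, rfl, h3⟩
      have k1 := YoungDiagram.lt_colLen_zero (YoungDiagram.mem_iff_lt_rowLen.2 h1)
      have k2 := YoungDiagram.lt_colLen_zero (YoungDiagram.mem_iff_lt_rowLen.2 h2)
      exact ⟨⟨c, ⟨r, k1⟩, ⟨s, k2⟩⟩, h3, ⟨rfl, rfl⟩, rfl, rfl⟩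
    · rintro ⟨⟨c', r', s'⟩, h3, ⟨rfl, rfl⟩, rfl, rfl⟩
      exact ⟨⟨h3.1, h3.2.1⟩, rfl, h3⟩
  · rintro ⟨c, r, s⟩ ⟨d, t, u⟩ h
    simp only [Prod.mk.injEq] at h
    obtain ⟨⟨h1, h2⟩, h3, -⟩ := h
    rw [Fin.ext h1, Fin.ext h3, h2]

end RowStandardFilling

theorem finsum_ncard_invertedSYT (Y : YoungDiagram) :
    (∑ᶠ k : ℕ, ((invertedSYT Y k).ncard : ℤ[X]) * Polynomial.X ^ k) =
      weightedChains (∑ i, shapeTuple Y i) (shapeTuple Y) := by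
  classical
  have := Fintype.ofFinite (RowStandardFilling Y)
  rw [← sum_X_pow_ncard_inversionSet _ (antitone_shapeTuple Y) (Equiv.refl _)]
  refine (finsum_ncard_fiber_mul (RowStandardFilling.NoRepeats (Y := Y)) RowStandardFilling.inv
    fun k => Polynomial.X ^ k).trans ?_
  rw [← card_cells_eq_sum_shapeTuple]
  refine Finset.sum_nbij RowStandardFilling.rowEntries ?_
    RowStandardFilling.rowEntries_injective.injOn ?_ ?_
  · intro τ hτ
    exact (mem_standardFillings _ _ _).2 (Finset.mem_filter.1 hτ).2.isStandardFilling
  · intro e he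
    obtain ⟨τ, hτ, rfl⟩ :=
      RowStandardFilling.exists_rowEntries_eq ((mem_standardFillings _ _ _).1 he)
    exact ⟨τ, by simpa using hτ, rfl⟩
  · intro τ hτ
    rw [(Finset.mem_filter.1 hτ).2.inv_eq_ncard]
    rfl

theorem MultiDyckPath.prod_pow_returnCount {m : ℕ} {lam : Fin m → ℕ} (P : MultiDyckPath lam) :
    ∏ j : Fin (m - 1), qNumber ((j : ℕ) + 2) ^ P.returnCount ((j : ℕ) + 1) =
      ∏ t : Fin (∑ i, lam i), stepWeight (P.vertex t.castSucc) (P.vertex t.succ) := by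
  classical
  unfold stepWeight
  -- With the product over degrees outermost, each degree contributes one equal factor per step that
  -- is a return of that degree.
  rw [Finset.prod_comm]
  refine Finset.prod_congr rfl fun j _ => ?_
  rw [← Finset.prod_filter, Finset.prod_const]
  rfl

theorem finsum_ncard_dyckPathsWithReturns {m : ℕ} {lam : Fin m → ℕ} (hlam : Antitone lam) :
    (∑ᶠ e : Fin (m - 1) → ℕ, ((dyckPathsWithReturns lam e).ncard : ℤ[X]) *
        ∏ j : Fin (m - 1), qNumber ((j : ℕ) + 2) ^ e j) =
      weightedChains (∑ i, lam i) lam := by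
  classical
  have := Fintype.ofFinite (MultiDyckPath lam)
  rw [← sum_prod_stepWeight hlam]
  have hset : ∀ e, dyckPathsWithReturns lam e =
      {P | True ∧ (fun j : Fin (m - 1) => P.returnCount ((j : ℕ) + 1)) = e} := by
    intro e
    ext P
    simp [dyckPathsWithReturns, funext_iff]
  simp only [hset]
  refine (finsum_ncard_fiber_mul (fun _ : MultiDyckPath lam => True)
    (fun P (j : Fin (m - 1)) => P.returnCount ((j : ℕ) + 1))
    fun e => ∏ j : Fin (m - 1), qNumber ((j : ℕ) + 2) ^ e j).trans ?_
  refine Finset.sum_nbij MultiDyckPath.vertex ?_ (fun P _ Q _ h => MultiDyckPath.ext h) ?_ ?_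
  · intro P _
    exact (mem_dyckPaths hlam _).2 ⟨P.vertex_zero, P.vertex_last, P.step, P.antitone⟩
  · intro v hv
    have h := (mem_dyckPaths hlam _).1 hv
    exact ⟨⟨v, h.zero, h.last, h.step, h.antitone⟩, by simp, rfl⟩
  · intro P _
    exact P.prod_pow_returnCount

theorem mainTheorem4 (Y : YoungDiagram) :
    (∑ᶠ k : ℕ, ((invertedSYT Y k).ncard : ℤ[X]) * Polynomial.X ^ k) =
      ∑ᶠ e : Fin (Y.colLen 0 - 1) → ℕ,
        ((dyckPathsWithReturns (shapeTuple Y) e).ncard : ℤ[X]) *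
          ∏ j : Fin (Y.colLen 0 - 1), qNumber ((j : ℕ) + 2) ^ e j := by
  rw [finsum_ncard_invertedSYT, finsum_ncard_dyckPathsWithReturns (antitone_shapeTuple Y)]
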